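/- Let $t_0\in\mathbb R$ and consider the system $\dot x=f(t,x)$, $t\ge t_0$, with state $x\in\mathbb R^n$. Assume that $f(t,x)$ is piecewise continuous in $t$ and continuously differentiable in $x$, that its Jacobian $\partial f/\partial x$ is bounded on $[t_0,T]\times C$ for every $T\ge t_0$ and every compact $C\subset\mathbb R^n$, and that every initial state $x$ at time $t_0$ has a solution $\xi(\cdot,t_0,x)$ on all of $[t_0,\infty)$ (forward completeness; this solution is then unique). Let $K\subset\mathbb R^n$ be a compact set with nonempty interior, put $\xi(t,t_0,K)=\{\xi(t,t_0,x):x\in K\}$, and let $|\cdot|$ be any norm on $\mathbb R^n$. For $T\ge0$ and $\varepsilon>0$ let $S(f,t_0,\varepsilon,T,K)$ be the minimal cardinality of a set $E\subset K$ such that for every $\bar x\in K$ there is $x\in E$ with $|\xi(t,t_0,\bar x)-\xi(t,t_0,x)|<\varepsilon$ for all $t\in[t_0,t_0+T]$. The topological entropy of the system with initial set $K$ at initial time $t_0$ is $$h(f,t_0,K)=\lim_{\varepsilon\searrow0}\limsup_{T\to\infty}\frac1T\log S(f,t_0,\varepsilon,T,K).$$ Suppose that $\hat A=[\hat a_{ij}]\in\mathbb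 R^{n\times n}$ is a Metzler matrix (all off-diagonal entries are nonnegative) such that, for all $i\ne j$ in $\{1,\dots,n\}$, $$\hat a_{ij}\ \ge\ \limsup_{t\to\infty}\ \max_{v\in\operatorname{co}(\xi(t,t_0,K))}\left|\frac{\partial f_i}{\partial x_j}(t,v)\right|,$$ and, for all $i\in\{1,\dots,n\}$, $$\hat a_{ii}\ \ge\ \limsup_{t\to\infty}\ \max_{v\in\operatorname{co}(\xi(t,t_0,K))}\frac{\partial f_i}{\partial x_i}(t,v),$$ where $\operatorname{co}$ denotes the convex hull. Then $$h(f,t_0,K)\ \le\ n\max\{\alpha(\hat A),0\},$$ where $\alpha(\hat A)$ is the largest real part of an eigenvalue of $\hat A$. -/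

import Mathlib

open Set Filter Topology MeasureTheory

namespace TVSys

/-- `g` is piecewise continuous on `[t₀, ∞)`: finitely many discontinuities in each bounded
interval `[t₀, T]`, and finite one-sided limits everywhere. -/
def PiecewiseContinuousFrom {F : Type*} [TopologicalSpace F] (t₀ : ℝ) (g : ℝ → F) : Prop :=
  (∀ T : ℝ, {t ∈ Icc t₀ T | ¬ ContinuousWithinAt g (Ici t₀) t}.Finite) ∧
  (∀ t, t₀ ≤ t → ∃ l, Tendsto g (𝓝[>] t) (𝓝 l)) ∧
  (∀ t, t₀ < t → ∃ l, Tendsto g (𝓝[<] t) (𝓝 l))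

/-- The standing regularity of the right-hand side of `ẋ = f (t, x)`, `t ≥ t₀`: piecewise
continuous in `t`, continuously differentiable in `x`, with a Jacobian that is bounded on bounded
time intervals and compact sets of states. The last clause holds whenever the Jacobian is
piecewise continuous in `t` jointly with `x`. -/
structure Regular {n : ℕ} (f : ℝ → (Fin n → ℝ) → (Fin n → ℝ)) (t₀ : ℝ) : Prop where
  piecewiseContinuous : ∀ x, PiecewiseContinuousFrom t₀ (fun t => f t x)
  contDiff : ∀ t, t₀ ≤ t → ContDiff ℝ 1 (f t)
  jacobian_locally_bounded : ∀ (T : ℝ) (C : Set (Fin n → ℝ)), IsCompact C →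
    ∃ L : ℝ, ∀ t ∈ Icc t₀ T, ∀ x ∈ C, ‖fderiv ℝ (f t) x‖ ≤ L

/-- `φ` is a solution on `[t₀, ∞)` of `ẋ = f (t, x)` with `φ t₀ = x₀`, in integrated form;
equivalently `φ` is locally absolutely continuous on `[t₀, ∞)` and satisfies the equation at
almost every time. -/
def IsSolution {n : ℕ} (f : ℝ → (Fin n → ℝ) → (Fin n → ℝ)) (t₀ : ℝ) (x₀ : Fin n → ℝ)
    (φ : ℝ → (Fin n → ℝ)) : Prop :=
  ContinuousOn φ (Ici t₀) ∧
  ∀ t, t₀ ≤ t → IntervalIntegrable (fun s => f s (φ s)) volume t₀ t ∧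
    φ t = x₀ + ∫ s in t₀..t, f s (φ s)

/-- Forward completeness: every initial state at time `t₀` has a solution on all of `[t₀, ∞)`. -/
def ForwardComplete {n : ℕ} (f : ℝ → (Fin n → ℝ) → (Fin n → ℝ)) (t₀ : ℝ) : Prop :=
  ∀ x₀, ∃ φ, IsSolution f t₀ x₀ φ

open Classical in
/-- `flow f t₀ t x` is the value `ξ(t, t₀, x)` at time `t ≥ t₀` of the solution with state `x` at
time `t₀`. -/
noncomputable def flow {n : ℕ} (f : ℝ → (Fin n → ℝ) → (Fin n → ℝ)) (t₀ t : ℝ)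
    (x : Fin n → ℝ) : Fin n → ℝ :=
  if h : ∃ φ, IsSolution f t₀ x φ then h.choose t else 0

/-- The reachable set `ξ(t, t₀, K)`. -/
noncomputable def reach {n : ℕ} (f : ℝ → (Fin n → ℝ) → (Fin n → ℝ)) (t₀ t : ℝ)
    (K : Set (Fin n → ℝ)) : Set (Fin n → ℝ) :=
  flow f t₀ t '' K

/-- The open ball of radius `ε` over the time horizon `T`, with respect to the norm `N`. -/
def dynBall {n : ℕ} (N : Seminorm ℝ (Fin n → ℝ)) (f : ℝ → (Fin n → ℝ) → (Fin n → ℝ)) (t₀ : ℝ)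
    (x : Fin n → ℝ) (ε T : ℝ) : Set (Fin n → ℝ) :=
  {y | ∀ t ∈ Icc t₀ (t₀ + T), N (flow f t₀ t y - flow f t₀ t x) < ε}

/-- `E` is a `(T, ε)`-spanning subset of `K`. -/
def IsSpanning {n : ℕ} (N : Seminorm ℝ (Fin n → ℝ)) (f : ℝ → (Fin n → ℝ) → (Fin n → ℝ)) (t₀ : ℝ)
    (ε T : ℝ) (K E : Set (Fin n → ℝ)) : Prop :=
  E ⊆ K ∧ K ⊆ ⋃ x ∈ E, dynBall N f t₀ x ε T

/-- `S(f, t₀, ε, T, K)`: the minimal cardinality of a `(T, ε)`-spanning set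
(`⊤` if there is no finite one). -/
noncomputable def minSpan {n : ℕ} (N : Seminorm ℝ (Fin n → ℝ))
    (f : ℝ → (Fin n → ℝ) → (Fin n → ℝ)) (t₀ ε T : ℝ) (K : Set (Fin n → ℝ)) : ℕ∞ :=
  ⨅ (E : Set (Fin n → ℝ)) (_ : IsSpanning N f t₀ ε T K E), E.encard

/-- The exponential growth rate `limsup_{T → ∞} (1/T) log S(f, t₀, ε, T, K)`. -/
noncomputable def entropyAt {n : ℕ} (N : Seminorm ℝ (Fin n → ℝ))
    (f : ℝ → (Fin n → ℝ) → (Fin n → ℝ)) (t₀ : ℝ) (K : Set (Fin n → ℝ)) (ε : ℝ) : EReal :=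
  limsup (fun T : ℝ => ENNReal.log (minSpan N f t₀ ε T K : ENNReal) / (T : EReal)) atTop

/-- The topological entropy `h(f, t₀, K)`: the limit of the growth rates as `ε ↘ 0`, which is
their supremum because they are nonincreasing in `ε`; see `tendsto_entropyAt`. -/
noncomputable def entropy {n : ℕ} (N : Seminorm ℝ (Fin n → ℝ))
    (f : ℝ → (Fin n → ℝ) → (Fin n → ℝ)) (t₀ : ℝ) (K : Set (Fin n → ℝ)) : EReal :=
  ⨆ (ε : ℝ) (_ : 0 < ε), entropyAt N f t₀ K ε

theorem entropyAt_antitone {n : ℕ} (N : Seminorm ℝ (Fin n → ℝ))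
    (f : ℝ → (Fin n → ℝ) → (Fin n → ℝ)) (t₀ : ℝ) (K : Set (Fin n → ℝ)) :
    Antitone (entropyAt N f t₀ K) := by
  intro ε δ h
  refine limsup_le_limsup ?_
  filter_upwards [eventually_gt_atTop (0 : ℝ)] with T hT
  refine EReal.div_le_div_right_of_nonneg (by exact_mod_cast hT.le) ?_
  refine ENNReal.log_monotone ?_
  refine ENat.toENNReal_le.2 ?_
  refine le_iInf₂ fun E hE => iInf₂_le E ⟨hE.1, hE.2.trans ?_⟩
  exact iUnion₂_mono fun x _ y hy t ht => (hy t ht).trans_le h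

theorem tendsto_entropyAt {n : ℕ} (N : Seminorm ℝ (Fin n → ℝ))
    (f : ℝ → (Fin n → ℝ) → (Fin n → ℝ)) (t₀ : ℝ) (K : Set (Fin n → ℝ)) :
    Tendsto (entropyAt N f t₀ K) (𝓝[>] 0) (𝓝 (entropy N f t₀ K)) := by
  have h := (entropyAt_antitone N f t₀ K).tendsto_nhdsGT (0 : ℝ)
  rwa [sSup_image] at h

/-- `∂f_i/∂x_j (t, v)`. -/
noncomputable def partialDeriv {n : ℕ} (f : ℝ → (Fin n → ℝ) → (Fin n → ℝ)) (i j : Fin n) (t : ℝ)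
    (v : Fin n → ℝ) : ℝ :=
  fderiv ℝ (f t) v (Pi.single j 1) i

/-- Metzler matrices: nonnegative off-diagonal entries. -/
def IsMetzler {n : ℕ} (M : Matrix (Fin n) (Fin n) ℝ) : Prop :=
  ∀ i j, i ≠ j → 0 ≤ M i j

/-- The largest real part of a complex eigenvalue of `M`. -/
noncomputable def spectralAbscissa {n : ℕ} (M : Matrix (Fin n) (Fin n) ℝ) : ℝ :=
  sSup {r : ℝ | ∃ z : ℂ,
    Module.End.HasEigenvalue (Matrix.toLin' (M.map (algebraMap ℝ ℂ))) z ∧ z.re = r}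

end TVSys

namespace TVSys

/-! Fix `μ > max (α(Â)) 0`. Perron-Frobenius theory for the Metzler matrix `Â` gives a positive
vector `p` with `Â p < μ p` (`IsMetzler.exists_pos_mulVec_lt`), and the strict inequality survives
adding a small `δ` to every entry. From some time on, the enlarged matrix dominates the Jacobian on
the convex hull of the reachable set. By the mean value theorem on segments, the absolute components
of the difference of two solutions then form a subsolution of a linear cooperative system, for which
multiples of `p e^{μ t}` are barriers (`abs_lt_mul_exp_of_integral`).

Before that time, solutions from the compact set `K` are uniformly Lipschitz in their initial states
(`Regular.exists_norm_flow_sub_le`). Together, solutions from `K` diverge at most like `M e^{μ (t -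
t₀)}`, so a grid of mesh of order `ε e^{-μ T}` yields a spanning set with `O(e^{n μ T})` points.
Hence the entropy is at most `n μ`; finally `μ` decreases to `max (α(Â)) 0`. -/

/-! ### Perron-Frobenius theory for Metzler matrices -/

theorem le_spectralAbscissa {n : ℕ} (A : Matrix (Fin n) (Fin n) ℝ) {s : ℝ}
    (h : (s • (1 : Matrix (Fin n) (Fin n) ℝ) - A).det = 0) : s ≤ spectralAbscissa A := by
  refine le_csSup ?_ ?_
  · have hfin : {z : ℂ | Module.End.HasEigenvalue
        (Matrix.toLin' (A.map (algebraMap ℝ ℂ))) z}.Finite :=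
      Module.End.finite_hasEigenvalue _
    refine ((hfin.image Complex.re).subset ?_).bddAbove
    rintro r ⟨z, hz, rfl⟩
    exact ⟨z, hz, rfl⟩
  · obtain ⟨v, hv0, hv⟩ := Matrix.exists_mulVec_eq_zero_iff.2 h
    have hv' : A.mulVec v = s • v := by
      rw [Matrix.sub_mulVec, Matrix.smul_mulVec, Matrix.one_mulVec, sub_eq_zero] at hv
      exact hv.symm
    refine ⟨(s : ℂ), ?_, Complex.ofReal_re s⟩
    refine Module.End.hasEigenvalue_of_hasEigenvector (x := fun i => (v i : ℂ)) ⟨?_, ?_⟩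
    · rw [Module.End.mem_eigenspace_iff, Matrix.toLin'_apply]
      ext i
      have := congrArg (fun r : ℝ => (r : ℂ)) (congrFun hv' i)
      simpa [Matrix.mulVec, dotProduct] using this
    · intro h0
      apply hv0
      ext i
      have := congrFun h0 i
      simpa using this

/-- The subinvariant vector of Perron-Frobenius theory, for Metzler matrices. -/
theorem IsMetzler.exists_pos_mulVec_lt {n : ℕ} {A : Matrix (Fin n) (Fin n) ℝ} (hA : IsMetzler A)
    {μ : ℝ} (hμ : spectralAbscissa A < μ) :
    ∃ p : Fin n → ℝ, (∀ i, 0 < p i) ∧ ∀ i, A.mulVec p i < μ * p i := by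
  set M : ℝ → Matrix (Fin n) (Fin n) ℝ := fun s => s • 1 - A with hM
  -- The solution of `(s - A) p = 1` by Cramer's formula, which makes its continuity in `s` evident.
  -- Positivity is carried from large `s` down to `μ`.
  set p : ℝ → Fin n → ℝ := fun s => (M s).det⁻¹ • (M s).adjugate.mulVec 1 with hp
  have hdet : ∀ s, μ ≤ s → (M s).det ≠ 0 := fun s hs h0 =>
    absurd (le_spectralAbscissa A h0) (not_le.2 (hμ.trans_le hs))
  have hMc : Continuous M :=
    (Continuous.smul continuous_id continuous_const).sub continuous_const
  have hpc : ContinuousOn p (Ici μ) := by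
    have h1 : ContinuousOn (fun s => (M s).det⁻¹) (Ici μ) :=
      hMc.matrix_det.continuousOn.inv₀ fun s hs => hdet s hs
    exact h1.smul (hMc.matrix_adjugate.matrix_mulVec continuous_const).continuousOn
  have heq : ∀ s, μ ≤ s → ∀ i, s * p s i - A.mulVec (p s) i = 1 := by
    intro s hs i
    have h1 : (M s).mulVec (p s) = 1 := by
      simp only [hp]
      rw [Matrix.mulVec_smul, Matrix.mulVec_mulVec, Matrix.mul_adjugate, Matrix.smul_mulVec,
        Matrix.one_mulVec, smul_smul, inv_mul_cancel₀ (hdet s hs), one_smul]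
    have h2 := congrFun h1 i
    simpa [hM, Matrix.sub_mulVec, Matrix.smul_mulVec] using h2
  suffices hpos : ∀ i, 0 < p μ i from
    ⟨p μ, hpos, fun i => by have := heq μ le_rfl i; linarith⟩
  obtain ⟨s₀, hs₀μ, hs₀⟩ : ∃ s₀, μ ≤ s₀ ∧ ∀ i, ∑ j, A i j < s₀ := by
    obtain ⟨b, hb⟩ := (Set.finite_range fun i => ∑ j, A i j).bddAbove
    refine ⟨max μ (b + 1), le_max_left _ _, fun i => ?_⟩
    have := hb ⟨i, rfl⟩
    exact lt_of_lt_of_le (by simp only at this; linarith) (le_max_right _ _)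
  -- Once `s₀` exceeds all row sums, the row of the smallest entry of `p s₀` forces that entry to be
  -- positive.
  have hpos₀ : ∀ i, 0 < p s₀ i := by
    intro i
    obtain ⟨k, -, hk⟩ := Finset.exists_min_image Finset.univ (p s₀) ⟨i, Finset.mem_univ i⟩
    refine lt_of_lt_of_le ?_ (hk i (Finset.mem_univ i))
    have h1 := heq s₀ hs₀μ k
    have h2 : (∑ j, A k j) * p s₀ k ≤ A.mulVec (p s₀) k := by
      rw [Finset.sum_mul]
      refine Finset.sum_le_sum fun j _ => ?_
      by_cases hkj : k = j
      · rw [hkj]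
      · exact mul_le_mul_of_nonneg_left (hk j (Finset.mem_univ j)) (hA k j hkj)
    have h3 : 1 ≤ (s₀ - ∑ j, A k j) * p s₀ k := by linarith
    by_contra hneg
    have := mul_nonpos_of_nonneg_of_nonpos (sub_nonneg.2 (hs₀ k).le) (not_lt.1 hneg)
    linarith
  by_contra! hcon
  have hclosed : IsCompact {s ∈ Icc μ s₀ | ∃ i, p s i ≤ 0} := by
    have : {s ∈ Icc μ s₀ | ∃ i, p s i ≤ 0} = ⋃ i, {s ∈ Icc μ s₀ | p s i ≤ 0} := by
      ext s; simp
    rw [this]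
    refine isCompact_iUnion fun i => isCompact_Icc.of_isClosed_subset ?_ fun s hs => hs.1
    exact isClosed_Icc.isClosed_le
      ((continuous_apply i).comp_continuousOn (hpc.mono Icc_subset_Ici_self)) continuousOn_const
  -- At the last failure of positivity all entries are nonnegative and entry `i` vanishes, so row
  -- `i` reads `1 = -(A p)_i ≤ 0`.
  obtain ⟨s, ⟨hs, i, hi⟩, hmax⟩ := hclosed.exists_isGreatest ⟨μ, ⟨le_rfl, hs₀μ⟩, hcon⟩
  have hss₀ : s < s₀ := lt_of_le_of_ne hs.2 fun h => absurd hi (not_le.2 (h ▸ hpos₀ i))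
  have hnonneg : ∀ j, 0 ≤ p s j := by
    intro j
    have ht : Tendsto (fun r => p r j) (𝓝[>] s) (𝓝 (p s j)) :=
      (((continuous_apply j).comp_continuousOn hpc) s hs.1).mono_left
        (nhdsWithin_mono _ fun r hr => hs.1.trans (le_of_lt hr))
    refine ge_of_tendsto ht ?_
    filter_upwards [Ioo_mem_nhdsGT hss₀] with r hr
    by_contra hneg
    exact absurd (hmax ⟨⟨hs.1.trans hr.1.le, hr.2.le⟩, j, (not_le.1 hneg).le⟩) (not_le.2 hr.1)
  have h0 : p s i = 0 := le_antisymm hi (hnonneg i)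
  have h1 := heq s hs.1 i
  have h2 : 0 ≤ A.mulVec (p s) i := by
    rw [Matrix.mulVec, dotProduct]
    refine Finset.sum_nonneg fun j _ => ?_
    by_cases hij : i = j
    · rw [← hij, h0, mul_zero]
    · exact mul_nonneg (hA i j hij) (hnonneg j)
  rw [h0, mul_zero] at h1
  linarith

/-! ### Comparison with linear cooperative systems -/

/-- Comparison with a linear cooperative system, by a strict barrier. -/
theorem abs_lt_mul_exp_of_integral {n : ℕ} {z g : ℝ → Fin n → ℝ} {a b : ℝ}
    (hz : ContinuousOn z (Icc a b))
    (hg : ∀ t ∈ Icc a b, IntervalIntegrable g volume a t)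
    (hzg : ∀ t ∈ Icc a b, z t = z a + ∫ s in a..t, g s)
    {B : Matrix (Fin n) (Fin n) ℝ} (hB : IsMetzler B) {p : Fin n → ℝ} (hp : ∀ i, 0 < p i) {μ : ℝ}
    (hμ : ∀ i, B.mulVec p i < μ * p i)
    (hineq : ∀ s ∈ Ico a b, ∀ i, z s i * g s i ≤ |z s i| * ∑ j, B i j * |z s j|)
    {c : ℝ} (h0 : ∀ i, |z a i| < c * p i) :
    ∀ t ∈ Icc a b, ∀ i, |z t i| < c * p i * Real.exp (μ * (t - a)) := by
  by_contra! hcon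
  obtain ⟨t₁, ht₁, i₁, hi₁⟩ := hcon
  have hzi : ∀ i, ContinuousOn (fun t => z t i) (Icc a b) := fun i =>
    (continuous_apply i).comp_continuousOn hz
  have hcompact : IsCompact {t ∈ Icc a b | ∃ i, c * p i * Real.exp (μ * (t - a)) ≤ |z t i|} := by
    have : {t ∈ Icc a b | ∃ i, c * p i * Real.exp (μ * (t - a)) ≤ |z t i|} =
        ⋃ i, {t ∈ Icc a b | c * p i * Real.exp (μ * (t - a)) ≤ |z t i|} := by
      ext s; simp
    rw [this]
    refine isCompact_iUnion fun i => isCompact_Icc.of_isClosed_subset ?_ fun s hs => hs.1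
    exact isClosed_Icc.isClosed_le (by fun_prop) (hzi i).abs
  -- The first time at which some component touches the barrier.
  obtain ⟨T, ⟨hT, i, hi⟩, hmin⟩ := hcompact.exists_isLeast ⟨t₁, ht₁, i₁, hi₁⟩
  have hlt : ∀ s ∈ Ico a T, ∀ j, |z s j| < c * p j * Real.exp (μ * (s - a)) := by
    intro s hs j
    by_contra hneg
    exact absurd (hmin ⟨⟨hs.1, hs.2.le.trans hT.2⟩, j, not_lt.1 hneg⟩) (not_le.2 hs.2)
  have haT : a < T := by
    refine lt_of_le_of_ne hT.1 fun h => ?_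
    rw [← h] at hi
    have := h0 i
    simp at hi
    linarith
  have hIio : 𝓝[<] T ≤ 𝓝[Icc a b] T := by
    rw [← nhdsWithin_Ioo_eq_nhdsLT haT]
    exact nhdsWithin_mono _ fun s hs => ⟨hs.1.le, hs.2.le.trans hT.2⟩
  have hlim : ∀ j, Tendsto (fun s => |z s j|) (𝓝[<] T) (𝓝 |z T j|) := fun j =>
    ((hzi j).abs T hT).mono_left hIio
  have hexp : ∀ k : ℝ, Tendsto (fun s => k * Real.exp (μ * (s - a))) (𝓝[<] T)
      (𝓝 (k * Real.exp (μ * (T - a)))) := fun k =>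
    ((by fun_prop : Continuous fun s => k * Real.exp (μ * (s - a))).tendsto T).mono_left
      nhdsWithin_le_nhds
  have hle : ∀ j, |z T j| ≤ c * p j * Real.exp (μ * (T - a)) := by
    intro j
    refine le_of_tendsto_of_tendsto (hlim j) (hexp _) ?_
    filter_upwards [Ioo_mem_nhdsLT haT] with s hs
    exact (hlt s ⟨hs.1.le, hs.2⟩ j).le
  have hieq := le_antisymm (hle i) hi
  have hc : 0 < c := by
    have := (abs_nonneg _).trans_lt (h0 i)
    exact pos_of_mul_pos_left this (hp i).le
  have hstrict : ∑ j, B i j * |z T j| < μ * (c * p i) * Real.exp (μ * (T - a)) := by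
    set e := c * Real.exp (μ * (T - a)) with he
    have he0 : 0 < e := by positivity
    calc ∑ j, B i j * |z T j| ≤ ∑ j, e * (B i j * p j) := by
          refine Finset.sum_le_sum fun j _ => ?_
          by_cases hij : i = j
          · subst hij
            rw [hieq]; exact le_of_eq (by rw [he]; ring)
          · refine (mul_le_mul_of_nonneg_left (hle j) (hB i j hij)).trans (le_of_eq ?_)
            rw [he]; ring
      _ = e * B.mulVec p i := by rw [← Finset.mul_sum]; rfl
      _ < e * (μ * p i) := mul_lt_mul_of_pos_left (hμ i) he0
      _ = _ := by rw [he]; ring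
  -- `σ` is the sign of `z T i`, so `|z i| = σ * z i` just before `T` and no derivative of `|·|` is
  -- needed.
  obtain ⟨σ, hσ, hσz⟩ : ∃ σ : ℝ, σ * σ = 1 ∧ σ * z T i = |z T i| := by
    rcases le_total 0 (z T i) with h | h
    · exact ⟨1, by norm_num, by rw [abs_of_nonneg h, one_mul]⟩
    · exact ⟨-1, by norm_num, by rw [abs_of_nonpos h]; ring⟩
  have hpos : 0 < σ * z T i := by
    rw [hσz, hieq]; have := hp i; positivity
  have hev : ∀ᶠ s in 𝓝[<] T, 0 < σ * z s i ∧
      ∑ j, B i j * |z s j| < μ * (c * p i) * Real.exp (μ * (s - a)) := by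
    refine Eventually.and ?_ ?_
    · exact (((hzi i T hT).mono_left hIio).const_mul σ).eventually (lt_mem_nhds hpos)
    · exact (tendsto_finsetSum _ fun j _ => (hlim j).const_mul (B i j)).eventually_lt
        (hexp _) hstrict
  obtain ⟨l, hl, hlT⟩ := (mem_nhdsLT_iff_exists_Ioo_subset' haT).1 hev
  obtain ⟨r, hr₁, hr₂⟩ := exists_between (max_lt haT hl : max a l < T)
  have har : a < r := (le_max_left _ _).trans_lt hr₁
  have hlr : l < r := (le_max_right _ _).trans_lt hr₁
  have hr : r ∈ Icc a b := ⟨har.le, hr₂.le.trans hT.2⟩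
  have hgrT : IntervalIntegrable g volume r T := (hg r hr).symm.trans (hg T hT)
  have hgi : IntervalIntegrable (fun s => g s i) volume r T :=
    ⟨(ContinuousLinearMap.proj (R := ℝ) (φ := fun _ : Fin n => ℝ) i).integrable_comp hgrT.1,
      (ContinuousLinearMap.proj (R := ℝ) (φ := fun _ : Fin n => ℝ) i).integrable_comp hgrT.2⟩
  have hdiff : z T i - z r i = ∫ s in r..T, g s i := by
    have h1 : z T - z r = ∫ s in r..T, g s := by
      rw [hzg T hT, hzg r hr, add_sub_add_left_eq_sub,
        intervalIntegral.integral_interval_sub_left (hg T hT) (hg r hr)]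
    have h2 := congrArg (ContinuousLinearMap.proj (R := ℝ) (φ := fun _ : Fin n => ℝ) i) h1
    rw [← ContinuousLinearMap.intervalIntegral_comp_comm _ hgrT] at h2
    simpa using h2
  -- On `[r, T]` component `i` gains no more than the barrier. As they meet at `T`, it was already
  -- on or above the barrier at `r < T`, a contradiction.
  have hbound : ∫ s in r..T, σ * g s i ≤
      ∫ s in r..T, μ * (c * p i) * Real.exp (μ * (s - a)) := by
    refine intervalIntegral.integral_mono_on_of_le_Ioo hr₂.le (hgi.const_mul σ)
      (Continuous.intervalIntegrable (by fun_prop) _ _) fun s hs => ?_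
    obtain ⟨h1, h2⟩ := hlT ⟨hlr.trans hs.1, hs.2⟩
    have habs : |z s i| = σ * z s i := by
      have : |σ| = 1 := by
        have := abs_mul_abs_self σ
        rw [hσ] at this
        nlinarith [abs_nonneg σ]
      rw [← abs_of_pos h1, abs_mul, this, one_mul]
    have h3 := hineq s ⟨har.le.trans hs.1.le, hs.2.trans_le hT.2⟩ i
    have h4 : (σ * z s i) * (σ * g s i) ≤ (σ * z s i) * ∑ j, B i j * |z s j| := by
      rw [← habs]
      calc |z s i| * (σ * g s i) = (σ * σ) * (z s i * g s i) := by rw [habs]; ring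
        _ ≤ _ := by rw [hσ, one_mul]; exact h3
    exact (le_of_mul_le_mul_left h4 h1).trans h2.le
  have hint : ∫ s in r..T, μ * (c * p i) * Real.exp (μ * (s - a)) =
      c * p i * Real.exp (μ * (T - a)) - c * p i * Real.exp (μ * (r - a)) := by
    refine intervalIntegral.integral_eq_sub_of_hasDerivAt
      (f := fun s => c * p i * Real.exp (μ * (s - a))) (fun s _ => ?_)
      (Continuous.intervalIntegrable (by fun_prop) _ _)
    have h1 : HasDerivAt (fun s => μ * (s - a)) μ s := by
      simpa using ((hasDerivAt_id s).sub_const a).const_mul μ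
    have h2 := (h1.exp).const_mul (c * p i)
    exact h2.congr_deriv (by ring)
  rw [intervalIntegral.integral_const_mul, ← hdiff, hint] at hbound
  have h5 := hlt r ⟨har.le, hr₂⟩ i
  have h6 : σ * z r i ≤ |z r i| := by
    rcases mul_self_eq_one_iff.1 hσ with h | h <;> rw [h]
    · rw [one_mul]; exact le_abs_self _
    · rw [neg_one_mul]; exact neg_le_abs _
  linarith

/-- The weights `p` cost only the ratio of an upper to a lower bound of its entries, so one constant
serves all functions and all time intervals. -/
theorem norm_le_mul_exp_of_integral {n : ℕ} {B : Matrix (Fin n) (Fin n) ℝ} (hB : IsMetzler B)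
    {p : Fin n → ℝ} (hp : ∀ i, 0 < p i) {μ : ℝ} (hμ : ∀ i, B.mulVec p i < μ * p i) :
    ∃ M : ℝ, 0 < M ∧ ∀ (z g : ℝ → Fin n → ℝ) (a b : ℝ), ContinuousOn z (Icc a b) →
      (∀ t ∈ Icc a b, IntervalIntegrable g volume a t) →
      (∀ t ∈ Icc a b, z t = z a + ∫ s in a..t, g s) →
      (∀ s ∈ Ico a b, ∀ i, z s i * g s i ≤ |z s i| * ∑ j, B i j * |z s j|) →
      ∀ t ∈ Icc a b, ‖z t‖ ≤ M * Real.exp (μ * (t - a)) * ‖z a‖ := by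
  obtain ⟨m, hm0, hm⟩ : ∃ m : ℝ, 0 < m ∧ ∀ i, m ≤ p i := by
    rcases isEmpty_or_nonempty (Fin n) with h | h
    · exact ⟨1, one_pos, fun i => h.elim i⟩
    · obtain ⟨k, hk⟩ := Finite.exists_min p
      exact ⟨p k, hp k, hk⟩
  have hP : ∀ i, p i ≤ ‖p‖ + 1 := fun i =>
    (le_abs_self _).trans ((norm_le_pi_norm p i).trans (by linarith))
  have hP0 : 0 < ‖p‖ + 1 := by positivity
  refine ⟨(‖p‖ + 1) / m, by positivity, fun z g a b hz hg hzg hineq t ht => ?_⟩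
  set k := (‖p‖ + 1) / m * Real.exp (μ * (t - a)) with hk
  have hk0 : 0 < k := by positivity
  rw [← div_le_iff₀' hk0]
  -- The barrier must start strictly above `z a`, which may be zero; hence the detour through `d >
  -- ‖z a‖`.
  refine le_of_forall_gt_imp_ge_of_dense fun d hd => ?_
  have hd0 : 0 < d := (norm_nonneg _).trans_lt hd
  rw [div_le_iff₀' hk0, pi_norm_le_iff_of_nonneg (by positivity)]
  intro i
  have hc : 0 < d / m := by positivity
  have h := abs_lt_mul_exp_of_integral hz hg hzg hB hp hμ hineq (c := d / m) (fun j => by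
    calc |z a j| ≤ ‖z a‖ := norm_le_pi_norm (z a) j
      _ < d := hd
      _ = d / m * m := by field_simp
      _ ≤ d / m * p j := mul_le_mul_of_nonneg_left (hm j) hc.le) t ht i
  refine h.le.trans ?_
  calc d / m * p i * Real.exp (μ * (t - a)) ≤ d / m * (‖p‖ + 1) * Real.exp (μ * (t - a)) := by
        gcongr; exact hP i
    _ = k * d := by rw [hk]; ring

/-! ### Divergence of solutions under Jacobian bounds -/

/-- The diagonal of the Jacobian of `f t` at `v` is bounded by that of `B`, and its off-diagonal
entries are bounded in absolute value by those of `B`. -/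
def JacobianLe {n : ℕ} (f : ℝ → (Fin n → ℝ) → (Fin n → ℝ)) (B : Matrix (Fin n) (Fin n) ℝ) (t : ℝ)
    (v : Fin n → ℝ) : Prop :=
  (∀ i, partialDeriv f i i t v ≤ B i i) ∧ ∀ i j, i ≠ j → |partialDeriv f i j t v| ≤ B i j

/-- Apply the mean value theorem to `f_i` on the segment. After multiplying by `(y - x) i`, the
diagonal entry meets a square, so a one-sided bound on it suffices. -/
theorem sub_mul_sub_le_of_jacobianLe {n : ℕ} {f : ℝ → (Fin n → ℝ) → (Fin n → ℝ)} {t : ℝ}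
    (hf : Differentiable ℝ (f t)) {B : Matrix (Fin n) (Fin n) ℝ} {x y : Fin n → ℝ}
    (h : ∀ v ∈ segment ℝ x y, JacobianLe f B t v) (i : Fin n) :
    (y - x) i * (f t y - f t x) i ≤ |(y - x) i| * ∑ j, B i j * |(y - x) j| := by
  obtain ⟨v, hv, hmv⟩ := domain_mvt (f := fun u => f t u i)
    (f' := fun u => (ContinuousLinearMap.proj (R := ℝ) (φ := fun _ : Fin n => ℝ) i).comp
      (fderiv ℝ (f t) u)) (s := segment ℝ x y)
    (fun u _ => ((hasFDerivAt_pi'.1 (hf u).hasFDerivAt) i).hasFDerivWithinAt)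
    (convex_segment x y) (left_mem_segment ℝ x y) (right_mem_segment ℝ x y)
  have hexp : (f t y - f t x) i = ∑ j, partialDeriv f i j t v * (y - x) j := by
    rw [Pi.sub_apply, hmv]
    have hsum : y - x = ∑ j, (y - x) j • (Pi.single j 1 : Fin n → ℝ) := by
      conv_lhs => rw [← Finset.univ_sum_single (y - x)]
      refine Finset.sum_congr rfl fun j _ => ?_
      rw [← Pi.single_smul, smul_eq_mul, mul_one]
    conv_lhs => rw [hsum]
    rw [map_sum]
    refine Finset.sum_congr rfl fun j _ => ?_
    rw [map_smul, smul_eq_mul, mul_comm]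
    rfl
  rw [hexp, Finset.mul_sum, Finset.mul_sum]
  refine Finset.sum_le_sum fun j _ => ?_
  by_cases hij : i = j
  · subst hij
    calc (y - x) i * (partialDeriv f i i t v * (y - x) i)
        = partialDeriv f i i t v * ((y - x) i * (y - x) i) := by ring
      _ ≤ B i i * ((y - x) i * (y - x) i) :=
          mul_le_mul_of_nonneg_right ((h v hv).1 i) (mul_self_nonneg _)
      _ = |(y - x) i| * (B i i * |(y - x) i|) := by
          rw [← abs_mul_abs_self ((y - x) i)]; ring
  · refine (le_abs_self _).trans ?_
    rw [abs_mul, abs_mul]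
    gcongr
    exact (h v hv).2 i j hij

theorem Regular.norm_sub_le {n : ℕ} {f : ℝ → (Fin n → ℝ) → (Fin n → ℝ)} {t₀ : ℝ}
    (hf : Regular f t₀) {B : Matrix (Fin n) (Fin n) ℝ} (hB : IsMetzler B)
    {p : Fin n → ℝ} (hp : ∀ i, 0 < p i) {μ : ℝ} (hμ : ∀ i, B.mulVec p i < μ * p i) :
    ∃ M : ℝ, 0 < M ∧ ∀ (x y : Fin n → ℝ) (φ ψ : ℝ → Fin n → ℝ) (a b : ℝ), t₀ ≤ a →
      IsSolution f t₀ x φ → IsSolution f t₀ y ψ →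
      (∀ s ∈ Ico a b, ∀ v ∈ segment ℝ (φ s) (ψ s), JacobianLe f B s v) →
      ∀ t ∈ Icc a b, ‖ψ t - φ t‖ ≤ M * Real.exp (μ * (t - a)) * ‖ψ a - φ a‖ := by
  obtain ⟨M, hM0, hM⟩ := norm_le_mul_exp_of_integral hB hp hμ
  refine ⟨M, hM0, fun x y φ ψ a b ha hφ hψ hJ t ht => ?_⟩
  have hii : ∀ {w χ}, IsSolution f t₀ w χ → ∀ t, a ≤ t →
      IntervalIntegrable (fun s => f s (χ s)) volume a t := fun hχ t hat =>
    (hχ.2 a ha).1.symm.trans (hχ.2 t (ha.trans hat)).1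
  have heq : ∀ {w χ}, IsSolution f t₀ w χ → ∀ t, a ≤ t →
      χ t = χ a + ∫ s in a..t, f s (χ s) := by
    intro w χ hχ t hat
    rw [(hχ.2 t (ha.trans hat)).2, (hχ.2 a ha).2, add_assoc,
      intervalIntegral.integral_add_adjacent_intervals (hχ.2 a ha).1 (hii hχ t hat)]
  have hsub : Icc a b ⊆ Ici t₀ := fun s hs => ha.trans hs.1
  refine hM (fun t => ψ t - φ t) (fun s => f s (ψ s) - f s (φ s)) a b
    ((hψ.1.mono hsub).sub (hφ.1.mono hsub))
    (fun t ht => (hii hψ t ht.1).sub (hii hφ t ht.1)) (fun t ht => ?_) (fun s hs i => ?_) t ht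
  · rw [intervalIntegral.integral_sub (hii hψ t ht.1) (hii hφ t ht.1)]
    rw [heq hψ t ht.1, heq hφ t ht.1]
    abel
  · exact sub_mul_sub_le_of_jacobianLe ((hf.contDiff s (ha.trans hs.1)).differentiable one_ne_zero)
      (hJ s hs) i

/-- Solutions that stay in a region where the Jacobian is bounded depend on their initial states
in a Lipschitz manner. -/
theorem Regular.norm_sub_le_of_segment_subset {n : ℕ} {f : ℝ → (Fin n → ℝ) → (Fin n → ℝ)} {t₀ : ℝ}
    (hf : Regular f t₀) {C : Set (Fin n → ℝ)} (hC : IsCompact C) (T : ℝ) :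
    ∃ M : ℝ, 0 < M ∧ ∀ (x y : Fin n → ℝ) (φ ψ : ℝ → Fin n → ℝ), ∀ b ≤ T,
      IsSolution f t₀ x φ → IsSolution f t₀ y ψ →
      (∀ s ∈ Ico t₀ b, segment ℝ (φ s) (ψ s) ⊆ C) →
      ∀ t ∈ Icc t₀ b, ‖ψ t - φ t‖ ≤ M * ‖ψ t₀ - φ t₀‖ := by
  obtain ⟨L, hL⟩ := hf.jacobian_locally_bounded T C hC
  set L' := max L 0
  -- For the matrix with all entries `L'` and `p = 1`, the row sums are `n * L'`; the `+ 1` makes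
  -- the inequality strict.
  obtain ⟨M, hM0, hM⟩ := hf.norm_sub_le (B := fun _ _ => L') (p := fun _ => 1)
    (μ := n * L' + 1) (fun _ _ _ => le_max_right _ _) (fun _ => one_pos)
    (fun i => by simp [Matrix.mulVec, dotProduct])
  have hμ : 0 ≤ n * L' + 1 := by positivity
  refine ⟨M * Real.exp ((n * L' + 1) * (T - t₀)), by positivity,
    fun x y φ ψ b hb hφ hψ hseg t ht => ?_⟩
  refine (hM x y φ ψ t₀ b le_rfl hφ hψ (fun s hs v hv => ?_) t ht).trans ?_
  · have hpd : ∀ i j, |partialDeriv f i j s v| ≤ L' := by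
      intro i j
      calc |partialDeriv f i j s v| ≤ ‖fderiv ℝ (f s) v (Pi.single j 1)‖ :=
            norm_le_pi_norm (fderiv ℝ (f s) v (Pi.single j 1)) i
        _ ≤ ‖fderiv ℝ (f s) v‖ * ‖(Pi.single j 1 : Fin n → ℝ)‖ :=
            ContinuousLinearMap.le_opNorm _ _
        _ = ‖fderiv ℝ (f s) v‖ := by rw [Pi.norm_single, norm_one, mul_one]
        _ ≤ L := hL s ⟨hs.1, hs.2.le.trans hb⟩ v (hseg s hs hv)
        _ ≤ L' := le_max_left _ _
    exact ⟨fun i => (le_abs_self _).trans (hpd i i), fun i j _ => hpd i j⟩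
  · have := ht.2.trans hb
    gcongr

/-! ### Bounds on finite time intervals -/

theorem IsSolution.apply_left {n : ℕ} {f : ℝ → (Fin n → ℝ) → (Fin n → ℝ)} {t₀ : ℝ}
    {x : Fin n → ℝ} {φ : ℝ → Fin n → ℝ} (h : IsSolution f t₀ x φ) : φ t₀ = x := by
  simpa using (h.2 t₀ le_rfl).2

theorem ForwardComplete.isSolution_flow {n : ℕ} {f : ℝ → (Fin n → ℝ) → (Fin n → ℝ)} {t₀ : ℝ}
    (hfc : ForwardComplete f t₀) (x : Fin n → ℝ) :
    IsSolution f t₀ x (fun t => flow f t₀ t x) := by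
  have h := hfc x
  have : (fun t => flow f t₀ t x) = h.choose := by
    funext t
    simp only [flow, dif_pos h]
  rw [this]
  exact h.choose_spec

/-- Near a given initial state, solutions stay within a tube of radius one. -/
theorem Regular.exists_tube {n : ℕ} {f : ℝ → (Fin n → ℝ) → (Fin n → ℝ)} {t₀ : ℝ}
    (hf : Regular f t₀) (T : ℝ) {x : Fin n → ℝ} {φ : ℝ → Fin n → ℝ} (hφ : IsSolution f t₀ x φ) :
    ∃ r : ℝ, 0 < r ∧ ∀ y ∈ Metric.ball x r, ∀ ψ, IsSolution f t₀ y ψ →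
      ∀ t ∈ Icc t₀ T, ‖ψ t - φ t‖ < 1 := by
  have himg : IsCompact (φ '' Icc t₀ T) :=
    isCompact_Icc.image_of_continuousOn (hφ.1.mono Icc_subset_Ici_self)
  obtain ⟨M, hM0, hM⟩ := hf.norm_sub_le_of_segment_subset (himg.cthickening (r := 1)) T
  refine ⟨min 1 (1 / M), by positivity, fun y hy ψ hψ => ?_⟩
  rw [Metric.mem_ball, dist_eq_norm, lt_min_iff, lt_div_iff₀' hM0] at hy
  by_contra! hcon
  obtain ⟨t₁, ht₁, hbig⟩ := hcon
  have hcompact : IsCompact {t ∈ Icc t₀ T | 1 ≤ ‖ψ t - φ t‖} := by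
    refine isCompact_Icc.of_isClosed_subset ?_ fun s hs => hs.1
    exact isClosed_Icc.isClosed_le continuousOn_const
      ((hψ.1.mono Icc_subset_Ici_self).sub (hφ.1.mono Icc_subset_Ici_self)).norm
  -- Up to the first exit time `b` the segments stay in the compact tube, so the Lipschitz bound
  -- gives distance below `1` at `b` too.
  obtain ⟨b, ⟨hb, hb1⟩, hmin⟩ := hcompact.exists_isLeast ⟨t₁, ht₁, hbig⟩
  have h := hM x y φ ψ b hb.2 hφ hψ (fun s hs => ?_) b ⟨hb.1, le_rfl⟩
  · rw [hφ.apply_left, hψ.apply_left] at h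
    linarith
  · have hsT : s ∈ Icc t₀ T := ⟨hs.1, hs.2.le.trans hb.2⟩
    have hlt : ‖ψ s - φ s‖ < 1 := by
      by_contra hneg
      exact absurd (hmin ⟨hsT, not_lt.1 hneg⟩) (not_le.2 hs.2)
    have hball : segment ℝ (φ s) (ψ s) ⊆ Metric.closedBall (φ s) 1 :=
      (convex_closedBall _ _).segment_subset (Metric.mem_closedBall_self zero_le_one)
        (by rw [Metric.mem_closedBall, dist_eq_norm]; exact hlt.le)
    exact hball.trans (Metric.closedBall_subset_cthickening (mem_image_of_mem _ hsT) _)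

/-- Finitely many of the balls supplied by `Regular.exists_tube` cover `K`. -/
theorem Regular.exists_norm_flow_le {n : ℕ} {f : ℝ → (Fin n → ℝ) → (Fin n → ℝ)} {t₀ : ℝ}
    (hf : Regular f t₀) (hfc : ForwardComplete f t₀) {K : Set (Fin n → ℝ)} (hK : IsCompact K)
    (T : ℝ) : ∃ R : ℝ, ∀ x ∈ K, ∀ t ∈ Icc t₀ T, ‖flow f t₀ t x‖ ≤ R := by
  refine hK.induction_on (p := fun S => ∃ R : ℝ, ∀ x ∈ S, ∀ t ∈ Icc t₀ T, ‖flow f t₀ t x‖ ≤ R)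
    ⟨0, by simp⟩ (fun S S' hS ⟨R, hR⟩ => ⟨R, fun x hx => hR x (hS hx)⟩) ?_ ?_
  · rintro S S' ⟨R, hR⟩ ⟨R', hR'⟩
    refine ⟨max R R', fun x hx t ht => ?_⟩
    rcases hx with hx | hx
    · exact (hR x hx t ht).trans (le_max_left _ _)
    · exact (hR' x hx t ht).trans (le_max_right _ _)
  · intro x _
    obtain ⟨r, hr0, hr⟩ := hf.exists_tube T (hfc.isSolution_flow x)
    obtain ⟨R, hR⟩ := (isCompact_Icc (a := t₀) (b := T)).exists_bound_of_continuousOn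
      ((hfc.isSolution_flow x).1.mono Icc_subset_Ici_self)
    refine ⟨Metric.ball x r, mem_nhdsWithin_of_mem_nhds (Metric.ball_mem_nhds x hr0), R + 1,
      fun y hy t ht => ?_⟩
    have h1 := hr y hy _ (hfc.isSolution_flow y) t ht
    have h2 := hR t ht
    have h3 := norm_le_norm_add_norm_sub' (flow f t₀ t y) (flow f t₀ t x)
    linarith

theorem Regular.exists_norm_flow_sub_le {n : ℕ} {f : ℝ → (Fin n → ℝ) → (Fin n → ℝ)} {t₀ : ℝ}
    (hf : Regular f t₀) (hfc : ForwardComplete f t₀) {K : Set (Fin n → ℝ)} (hK : IsCompact K)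
    (T : ℝ) : ∃ M : ℝ, 0 < M ∧ ∀ x ∈ K, ∀ y ∈ K, ∀ t ∈ Icc t₀ T,
      ‖flow f t₀ t y - flow f t₀ t x‖ ≤ M * ‖y - x‖ := by
  obtain ⟨R, hR⟩ := hf.exists_norm_flow_le hfc hK T
  obtain ⟨M, hM0, hM⟩ := hf.norm_sub_le_of_segment_subset
    (isCompact_closedBall (0 : Fin n → ℝ) R) T
  refine ⟨M, hM0, fun x hx y hy t ht => ?_⟩
  have h := hM x y _ _ T le_rfl (hfc.isSolution_flow x) (hfc.isSolution_flow y) (fun s hs => ?_) t ht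
  · rwa [(hfc.isSolution_flow x).apply_left, (hfc.isSolution_flow y).apply_left] at h
  · refine (convex_closedBall _ _).segment_subset ?_ ?_
    · exact mem_closedBall_zero_iff.2 (hR x hx s ⟨hs.1, hs.2.le⟩)
    · exact mem_closedBall_zero_iff.2 (hR y hy s ⟨hs.1, hs.2.le⟩)

/-! ### Exponential divergence on the whole half-line -/

/-- Exponential divergence estimate for solutions starting in `K`. -/
theorem exists_norm_flow_sub_le_exp {n : ℕ} {f : ℝ → (Fin n → ℝ) → (Fin n → ℝ)} {t₀ : ℝ}
    (hf : Regular f t₀) (hfc : ForwardComplete f t₀) {K : Set (Fin n → ℝ)} (hK : IsCompact K)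
    {A : Matrix (Fin n) (Fin n) ℝ} (hA : IsMetzler A)
    (hdiag : ∀ i, limsup (fun t : ℝ => ⨆ v ∈ convexHull ℝ (reach f t₀ t K),
      ((partialDeriv f i i t v : ℝ) : EReal)) atTop ≤ ((A i i : ℝ) : EReal))
    (hoff : ∀ i j, i ≠ j → limsup (fun t : ℝ => ⨆ v ∈ convexHull ℝ (reach f t₀ t K),
      ((|partialDeriv f i j t v| : ℝ) : EReal)) atTop ≤ ((A i j : ℝ) : EReal))
    {μ : ℝ} (hμ0 : 0 < μ) (hμ : spectralAbscissa A < μ) :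
    ∃ M : ℝ, 0 < M ∧ ∀ x ∈ K, ∀ y ∈ K, ∀ t, t₀ ≤ t →
      ‖flow f t₀ t y - flow f t₀ t x‖ ≤ M * Real.exp (μ * (t - t₀)) * ‖y - x‖ := by
  obtain ⟨p, hp, hAp⟩ := hA.exists_pos_mulVec_lt hμ
  -- The slack `δ` turns the limsup bounds into bounds valid from some time on, while keeping `B p <
  -- μ p`.
  obtain ⟨δ, hδ0, hδ⟩ : ∃ δ : ℝ, 0 < δ ∧ ∀ i, A.mulVec p i + δ * ∑ j, p j < μ * p i := by
    have hev : ∀ᶠ δ in 𝓝[>] (0 : ℝ), ∀ i, A.mulVec p i + δ * ∑ j, p j < μ * p i := by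
      refine eventually_all.2 fun i => ?_
      have hc : Continuous fun δ : ℝ => A.mulVec p i + δ * ∑ j, p j := by fun_prop
      refine nhdsWithin_le_nhds ((hc.tendsto 0).eventually (gt_mem_nhds ?_))
      simpa using hAp i
    obtain ⟨δ, h1, h2⟩ := (hev.and self_mem_nhdsWithin).exists
    exact ⟨δ, h2, h1⟩
  set B : Matrix (Fin n) (Fin n) ℝ := fun i j => A i j + δ with hBdef
  have hB : IsMetzler B := fun i j hij => add_nonneg (hA i j hij) hδ0.le
  have hBp : ∀ i, B.mulVec p i < μ * p i := by
    intro i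
    refine lt_of_eq_of_lt ?_ (hδ i)
    simp only [Matrix.mulVec, dotProduct, hBdef, add_mul, Finset.sum_add_distrib, Finset.mul_sum]
  have hJ : ∀ᶠ t in atTop, ∀ v ∈ convexHull ℝ (reach f t₀ t K), JacobianLe f B t v := by
    have h1 : ∀ᶠ t in atTop, ∀ i, (⨆ v ∈ convexHull ℝ (reach f t₀ t K),
        ((partialDeriv f i i t v : ℝ) : EReal)) < ((A i i + δ : ℝ) : EReal) :=
      eventually_all.2 fun i => eventually_lt_of_limsup_lt
        ((hdiag i).trans_lt (EReal.coe_lt_coe_iff.2 (by linarith)))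
    have h2 : ∀ᶠ t in atTop, ∀ i j, i ≠ j → (⨆ v ∈ convexHull ℝ (reach f t₀ t K),
        ((|partialDeriv f i j t v| : ℝ) : EReal)) < ((A i j + δ : ℝ) : EReal) :=
      eventually_all.2 fun i => eventually_all.2 fun j => eventually_imp_distrib_left.2 fun hij =>
        eventually_lt_of_limsup_lt
          ((hoff i j hij).trans_lt (EReal.coe_lt_coe_iff.2 (by linarith)))
    filter_upwards [h1, h2] with t h1 h2 v hv
    refine ⟨fun i => ?_, fun i j hij => ?_⟩
    · exact EReal.coe_le_coe_iff.1 ((le_iSup₂ (f := fun v (_ : v ∈ convexHull ℝ (reach f t₀ t K)) =>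
        ((partialDeriv f i i t v : ℝ) : EReal)) v hv).trans (h1 i).le)
    · exact EReal.coe_le_coe_iff.1 ((le_iSup₂ (f := fun v (_ : v ∈ convexHull ℝ (reach f t₀ t K)) =>
        ((|partialDeriv f i j t v| : ℝ) : EReal)) v hv).trans (h2 i j hij).le)
  obtain ⟨T, hTJ⟩ := eventually_atTop.1 (hJ.and (eventually_ge_atTop t₀))
  have hT : t₀ ≤ T := (hTJ T le_rfl).2
  obtain ⟨M₁, hM₁0, hM₁⟩ := hf.exists_norm_flow_sub_le hfc hK T
  obtain ⟨M₂, hM₂0, hM₂⟩ := hf.norm_sub_le hB hp hBp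
  refine ⟨max M₁ (M₂ * M₁), lt_max_of_lt_left hM₁0, fun x hx y hy t ht => ?_⟩
  rcases le_total t T with htT | htT
  · have hexp : 1 ≤ Real.exp (μ * (t - t₀)) :=
      Real.one_le_exp (mul_nonneg hμ0.le (sub_nonneg.2 ht))
    calc ‖flow f t₀ t y - flow f t₀ t x‖ ≤ M₁ * 1 * ‖y - x‖ := by
          rw [mul_one]; exact hM₁ x hx y hy t ⟨ht, htT⟩
      _ ≤ _ := by gcongr; exact le_max_left _ _
  · have h := hM₂ x y _ _ T t hT (hfc.isSolution_flow x) (hfc.isSolution_flow y)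
      (fun s hs v hv => (hTJ s hs.1).1 v ((convex_convexHull ℝ _).segment_subset
        (subset_convexHull ℝ _ (mem_image_of_mem _ hx))
        (subset_convexHull ℝ _ (mem_image_of_mem _ hy)) hv)) t ⟨htT, le_rfl⟩
    calc ‖flow f t₀ t y - flow f t₀ t x‖
        ≤ M₂ * Real.exp (μ * (t - T)) * ‖flow f t₀ T y - flow f t₀ T x‖ := h
      _ ≤ M₂ * Real.exp (μ * (t - t₀)) * (M₁ * ‖y - x‖) := by
          gcongr
          exact hM₁ x hx y hy T ⟨hT, le_rfl⟩
      _ = M₂ * M₁ * Real.exp (μ * (t - t₀)) * ‖y - x‖ := by ring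
      _ ≤ _ := by gcongr; exact le_max_right _ _

/-! ### Grid coverings and the entropy count -/

/-- Cut space into cubes of side `r` and pick one point of `K` in each cube that meets `K`; this
keeps the centres inside `K`. -/
theorem exists_subset_encard_le {n : ℕ} {K : Set (Fin n → ℝ)} {R : ℝ}
    (hR : ∀ x ∈ K, ‖x‖ ≤ R) {r : ℝ} (hr : 0 < r) :
    ∃ E ⊆ K, E.encard ≤ (((2 * ⌈R / r⌉₊ + 1) ^ n : ℕ) : ℕ∞) ∧ ∀ x ∈ K, ∃ y ∈ E, ‖x - y‖ ≤ r := by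
  set m : ℤ := (⌈R / r⌉₊ : ℤ) with hm
  set F : (Fin n → ℝ) → Fin n → ℤ := fun x i => ⌊x i / r⌋ with hF
  have hsub : F '' K ⊆ (Fintype.piFinset fun _ : Fin n => Finset.Icc (-m) m : Finset _) := by
    rintro _ ⟨x, hx, rfl⟩
    rw [Finset.mem_coe, Fintype.mem_piFinset]
    intro i
    have h1 : |x i| / r ≤ R / r := by
      gcongr
      exact (norm_le_pi_norm x i).trans (hR x hx)
    have h2 : |x i / r| ≤ (m : ℝ) := by
      rw [abs_div, abs_of_pos hr, hm]
      exact h1.trans (by exact_mod_cast Nat.le_ceil _)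
    obtain ⟨h3, h4⟩ := abs_le.1 h2
    rw [Finset.mem_Icc]
    refine ⟨Int.le_floor.2 (by push_cast; exact h3), ?_⟩
    exact_mod_cast (Int.floor_le (x i / r)).trans h4
  obtain ⟨E, hEK, hbij⟩ := (surjOn_image F K).exists_bijOn_subset
  refine ⟨E, hEK, ?_, fun x hx => ?_⟩
  · rw [← hbij.injOn.encard_image, hbij.image_eq]
    refine (encard_le_encard hsub).trans ?_
    rw [encard_coe_eq_coe_finsetCard, Fintype.card_piFinset]
    simp only [Int.card_Icc, Finset.prod_const, Finset.card_univ, Fintype.card_fin]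
    refine le_of_eq ?_
    congr 2
    omega
  · obtain ⟨y, hy, hyx⟩ := hbij.surjOn (mem_image_of_mem F hx)
    refine ⟨y, hy, (pi_norm_le_iff_of_nonneg hr.le).2 fun i => ?_⟩
    have h1 : ⌊x i / r⌋ = ⌊y i / r⌋ := (congrFun hyx i).symm
    have h2 := Int.abs_sub_lt_one_of_floor_eq_floor h1
    rw [← sub_div, abs_div, abs_of_pos hr, div_lt_one hr] at h2
    exact h2.le

theorem exists_seminorm_le_mul_norm {n : ℕ} (N : Seminorm ℝ (Fin n → ℝ)) :
    ∃ c : ℝ, 0 < c ∧ ∀ x, N x ≤ c * ‖x‖ := by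
  refine ⟨∑ i, N (Pi.single i 1) + 1,
    add_pos_of_nonneg_of_pos (Finset.sum_nonneg fun i _ => apply_nonneg N _) one_pos, fun x => ?_⟩
  calc N x = N (∑ i, x i • (Pi.single i 1 : Fin n → ℝ)) := by
        congr 1
        conv_lhs => rw [← Finset.univ_sum_single x]
        refine Finset.sum_congr rfl fun j _ => ?_
        rw [← Pi.single_smul, smul_eq_mul, mul_one]
    _ ≤ ∑ i, N (x i • (Pi.single i 1 : Fin n → ℝ)) :=
        Finset.le_sum_of_subadditive N (map_zero N).le (map_add_le_add N) _ _
    _ ≤ ∑ i, N (Pi.single i 1) * ‖x‖ := by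
        refine Finset.sum_le_sum fun i _ => ?_
        rw [map_smul_eq_mul, mul_comm]
        exact mul_le_mul_of_nonneg_left (norm_le_pi_norm x i) (apply_nonneg N _)
    _ ≤ (∑ i, N (Pi.single i 1) + 1) * ‖x‖ := by
        rw [← Finset.sum_mul]
        gcongr
        linarith

theorem entropyAt_le_of_norm_flow_sub_le {n : ℕ} (N : Seminorm ℝ (Fin n → ℝ))
    {f : ℝ → (Fin n → ℝ) → (Fin n → ℝ)} {t₀ : ℝ} {K : Set (Fin n → ℝ)} (hK : IsCompact K)
    {M μ : ℝ} (hM : 0 < M) (hμ : 0 < μ)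
    (h : ∀ x ∈ K, ∀ y ∈ K, ∀ t, t₀ ≤ t →
      ‖flow f t₀ t y - flow f t₀ t x‖ ≤ M * Real.exp (μ * (t - t₀)) * ‖y - x‖)
    {ε : ℝ} (hε : 0 < ε) : entropyAt N f t₀ K ε ≤ ((n * μ : ℝ) : EReal) := by
  obtain ⟨c, hc0, hc⟩ := exists_seminorm_le_mul_norm N
  obtain ⟨R, hR0, hR⟩ : ∃ R : ℝ, 0 < R ∧ ∀ x ∈ K, ‖x‖ ≤ R := by
    obtain ⟨R, hR⟩ := hK.isBounded.exists_norm_le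
    exact ⟨max R 1, lt_max_of_lt_right one_pos, fun x hx => (hR x hx).trans (le_max_left _ _)⟩
  -- Chosen so that `2 * ⌈R / r⌉₊ + 1 ≤ D * exp (μ T)`; the `3` absorbs the rounding.
  set D := 4 * R * c * M / ε + 3 with hD
  have hD0 : 0 < D := by positivity
  have hspan : ∀ T : ℝ, 0 < T →
      (minSpan N f t₀ ε T K : ENNReal) ≤ ENNReal.ofReal ((D * Real.exp (μ * T)) ^ n) := by
    intro T hT
    -- With this mesh, points of one cube stay within `ε / 2` up to time `t₀ + T`; as `μ > 0`, the
    -- bound is worst at the final time.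
    set r := ε / (2 * c * M * Real.exp (μ * T)) with hr
    have hr0 : 0 < r := by positivity
    obtain ⟨E, hEK, hcard, hE⟩ := exists_subset_encard_le hR hr0
    have hmin : minSpan N f t₀ ε T K ≤ E.encard := by
      refine iInf₂_le E ⟨hEK, fun x hx => ?_⟩
      obtain ⟨y, hy, hxy⟩ := hE x hx
      refine mem_iUnion₂.2 ⟨y, hy, fun t ht => ?_⟩
      have htT : t - t₀ ≤ T := by linarith [ht.2]
      calc N (flow f t₀ t x - flow f t₀ t y) ≤ c * ‖flow f t₀ t x - flow f t₀ t y‖ := hc _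
        _ ≤ c * (M * Real.exp (μ * (t - t₀)) * ‖x - y‖) := by
            gcongr; exact h y (hEK hy) x hx t ht.1
        _ ≤ c * (M * Real.exp (μ * T) * r) := by gcongr
        _ = ε / 2 := by rw [hr]; field_simp
        _ < ε := half_lt_self hε
    calc (minSpan N f t₀ ε T K : ENNReal)
        ≤ ((((2 * ⌈R / r⌉₊ + 1) ^ n : ℕ) : ℕ∞) : ENNReal) :=
          ENat.toENNReal_le.2 (hmin.trans hcard)
      _ = ENNReal.ofReal ((((2 * ⌈R / r⌉₊ + 1) ^ n : ℕ)) : ℝ) := by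
          rw [ENat.toENNReal_coe, ENNReal.ofReal_natCast]
      _ ≤ _ := by
          refine ENNReal.ofReal_le_ofReal ?_
          push_cast
          have h1 := (Nat.ceil_lt_add_one (by positivity : 0 ≤ R / r)).le
          have h2 : 1 ≤ Real.exp (μ * T) := Real.one_le_exp (by positivity)
          have h3 : R / r = 2 * R * c * M / ε * Real.exp (μ * T) := by
            rw [hr]; field_simp
          refine pow_le_pow_left₀ (by positivity) ?_ n
          calc 2 * (⌈R / r⌉₊ : ℝ) + 1 ≤ 2 * (R / r) + 3 := by linarith
            _ ≤ 2 * (R / r) + 3 * Real.exp (μ * T) := by linarith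
            _ = D * Real.exp (μ * T) := by rw [h3, hD]; ring
  have hlim : Tendsto (fun T : ℝ => ((n * Real.log D / T + n * μ : ℝ) : EReal)) atTop
      (𝓝 ((n * μ : ℝ) : EReal)) := by
    refine (continuous_coe_real_ereal.tendsto _).comp ?_
    simpa using (tendsto_id.const_div_atTop (n * Real.log D)).add_const (n * μ)
  rw [← hlim.limsup_eq]
  refine limsup_le_limsup ?_
  filter_upwards [eventually_gt_atTop (0 : ℝ)] with T hT
  calc ENNReal.log (minSpan N f t₀ ε T K : ENNReal) / (T : EReal)
      ≤ ENNReal.log (ENNReal.ofReal ((D * Real.exp (μ * T)) ^ n)) / (T : EReal) :=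
        EReal.div_le_div_right_of_nonneg (by exact_mod_cast hT.le)
          (ENNReal.log_monotone (hspan T hT))
    _ = ((Real.log ((D * Real.exp (μ * T)) ^ n) / T : ℝ) : EReal) := by
        rw [ENNReal.log_ofReal_of_pos (by positivity), EReal.coe_div]
    _ = ((n * Real.log D / T + n * μ : ℝ) : EReal) := by
        congr 1
        rw [Real.log_pow, Real.log_mul hD0.ne' (Real.exp_ne_zero _), Real.log_exp]
        field_simp

end TVSys

theorem proposition1 {n : ℕ}
    (N : Seminorm ℝ (Fin n → ℝ)) (hN : ∀ x, N x = 0 → x = 0)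
    (f : ℝ → (Fin n → ℝ) → (Fin n → ℝ)) (t₀ : ℝ)
    (hf : TVSys.Regular f t₀) (hfc : TVSys.ForwardComplete f t₀)
    (K : Set (Fin n → ℝ)) (hK : IsCompact K) (hKi : (interior K).Nonempty)
    (A : Matrix (Fin n) (Fin n) ℝ) (hA : TVSys.IsMetzler A)
    (hdiag : ∀ i, limsup (fun t : ℝ => ⨆ v ∈ convexHull ℝ (TVSys.reach f t₀ t K),
      ((TVSys.partialDeriv f i i t v : ℝ) : EReal)) atTop ≤ ((A i i : ℝ) : EReal))
    (hoff : ∀ i j, i ≠ j → limsup (fun t : ℝ => ⨆ v ∈ convexHull ℝ (TVSys.reach f t₀ t K),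
      ((|TVSys.partialDeriv f i j t v| : ℝ) : EReal)) atTop ≤ ((A i j : ℝ) : EReal)) :
    TVSys.entropy N f t₀ K ≤ (((n : ℝ) * max (TVSys.spectralAbscissa A) 0 : ℝ) : EReal) := by
  refine iSup₂_le fun ε hε => ?_
  have hbound : ∀ μ : ℝ, max (TVSys.spectralAbscissa A) 0 < μ →
      TVSys.entropyAt N f t₀ K ε ≤ ((n * μ : ℝ) : EReal) := by
    intro μ hμ
    obtain ⟨hμ₁, hμ₀⟩ := max_lt_iff.1 hμ
    obtain ⟨M, hM0, hM⟩ := TVSys.exists_norm_flow_sub_le_exp hf hfc hK hA hdiag hoff hμ₀ hμ₁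
    exact TVSys.entropyAt_le_of_norm_flow_sub_le N hK hM0 hμ₀ hM hε
  have hc : Continuous fun μ : ℝ => ((n * μ : ℝ) : EReal) :=
    continuous_coe_real_ereal.comp (continuous_const.mul continuous_id)
  have hlim := (hc.tendsto (max (TVSys.spectralAbscissa A) 0)).mono_left
    (nhdsWithin_le_nhds (s := Ioi (max (TVSys.spectralAbscissa A) 0)))
  refine ge_of_tendsto hlim ?_
  filter_upwards [self_mem_nhdsWithin] with μ hμ
  exact hbound μ hμ
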